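/- Let $p,\delta,\epsilon\in[0,1]$. Consider the three-user interference channel with feedback in which all the variables below take values in $\{0,1\}$, transmitters $1,2,3$ send $(X_{11},X_{12})$, $X_2$ and $(X_{32},X_{33})$ respectively, and receivers $1,2,3$ observe $Y_1$, $(Y_2,Y_2')$ and $Y_3$ respectively, where $$Y_1=X_{11}\oplus N_p,\qquad Y_2=X_2\oplus N_p,\qquad Y_2'=X_{12}\oplus N_\delta\oplus\big((X_{12}\oplus X_{32})\wedge E\big),\qquad Y_3=X_{33}\oplus N_p\oplus N_\epsilon .$$ Here $\oplus$ is addition modulo $2$, and $N_p,N_\delta,N_\epsilon,E$ are mutually independent Bernoulli random variables with $P(N_p=1)=p$, $P(N_\delta=1)=\delta$, $P(N_\epsilon=1)=\epsilon$, $P(E=1)=\tfrac12$, drawn independently in each channel use. Transmitters $1$ and $3$ receive the noiseless feedback $Z_1=Y_1$ and $Z_3=Y_3$ with unit delay, and transmitter $2$ receives no feedback. For positive integers $M_1,M_2,M_3,N$, a code consists of encoding functions $f_{i,n}:\{1,\dots,M_i\}\times\mathcal Z_i^{n-1}\to\mathcal X_i$ ($1\le n\le N$) and decoding functions $g_i:\mathcal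 Y_i^N\to\{1,\dots,M_i\}$, $i\in\{1,2,3\}$, where $\mathcal X_i,\mathcal Y_i,\mathcal Z_i$ are the input, output and feedback alphabets of user $i$. For independent, uniformly distributed messages $W_1,W_2,W_3$, let $P_e$ be the probability that at least one message is decoded incorrectly. For $\eta>0$, a triple $(R_1,R_2,R_3)\in\mathbb R^3$ is $\eta$-achievable by the code if $P_e\le\eta$ and $\frac1N\log_2 M_i\ge R_i-\eta$ for $i=1,2,3$. It is $\eta$-achievable if it is $\eta$-achievable by some code (with some $M_1,M_2,M_3,N$), or by some randomized coding strategy, that is, a probability measure on the encoding functions such that with probability one there are decoding functions which, together with the chosen encoding functions, form a code by which the triple is $\eta$-achievable. The feedback-capacity region $\mathcal C_\epsilon$ is the set of all triples in $\mathbb R^3$ that are $\eta$-achievable for every $\eta>0$. Then, for any $p,\delta\in[0,1]$ and any $(R_1,R_2,R_3)\in\mathcal C_0$, there exist a continuous function $\zeta:\mathbb R\to\mathbb R$ with $\zeta(\epsilon)\to0$ as $\epsilon\to0^+$ and an $\epsilon_0>0$ such that, for all $\epsilon\in[0,1]$ with $0<\epsilon<\epsilon_0$, $$(R_1-\zeta(\epsilon),\,R_2-\zeta(\epsilon),\,R_3-\zeta(\epsilon))\in\mathcal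 C_\epsilon .$$ -/

import Mathlib

open Filter Topology

noncomputable section

/-- A three-user interference channel with (generalized) feedback, with finite alphabets.
Users are indexed by `Fin 3`. `Q x y` is the probability `Q(y | x)` of the output triple `y` given
the input triple `x`, and `P y z` is the probability `P(z | y)` of the feedback triple `z` given the
output triple `y`. -/
structure ICFB where
  /-- input alphabets -/
  X : Fin 3 → Type
  /-- output alphabets -/
  Y : Fin 3 → Type
  /-- feedback alphabets -/
  Z : Fin 3 → Type
  [fintypeX : ∀ i, Fintype (X i)]
  [fintypeY : ∀ i, Fintype (Y i)]
  [fintypeZ : ∀ i, Fintype (Z i)]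
  Q : (∀ i, X i) → (∀ i, Y i) → ℝ
  Q_nonneg : ∀ x y, 0 ≤ Q x y
  Q_sum : ∀ x, ∑ y, Q x y = 1
  P : (∀ i, Y i) → (∀ i, Z i) → ℝ
  P_nonneg : ∀ y z, 0 ≤ P y z
  P_sum : ∀ y, ∑ z, P y z = 1

namespace ICFB

attribute [instance] ICFB.fintypeX ICFB.fintypeY ICFB.fintypeZ

/-- The three sequences of encoding functions of a code with `M i` messages for user `i` and
blocklength `N`. At time `n` (times are `0, …, N - 1`) encoder `i` sees its message and the `n`
feedback symbols it received at the earlier times. -/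
def Encoder (ch : ICFB) (M : Fin 3 → ℕ) (N : ℕ) : Type :=
  ∀ i : Fin 3, Fin (M i) → ∀ n : Fin N, (Fin (n : ℕ) → ch.Z i) → ch.X i

/-- The three decoding functions: decoder `i` sees the whole output block of user `i`. -/
def Decoder (ch : ICFB) (M : Fin 3 → ℕ) (N : ℕ) : Type :=
  ∀ i : Fin 3, (Fin N → ch.Y i) → Fin (M i)

/-- The input triple at time `n`, for messages `w` and feedback sequences `z`. It depends only on
the feedback symbols at times before `n`. -/
def input (ch : ICFB) {M : Fin 3 → ℕ} {N : ℕ} (f : ch.Encoder M N) (w : ∀ i, Fin (M i))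
    (z : Fin N → ∀ i, ch.Z i) (n : Fin N) : ∀ i, ch.X i :=
  fun i => f i (w i) n (fun k => z (k.castLE n.isLt.le) i)

/-- The joint probability of messages `w`, outputs `y` and feedback `z`: the messages are
independent and uniform, and the channel is memoryless. -/
def jointProb (ch : ICFB) {M : Fin 3 → ℕ} {N : ℕ} (f : ch.Encoder M N) (w : ∀ i, Fin (M i))
    (y : Fin N → ∀ i, ch.Y i) (z : Fin N → ∀ i, ch.Z i) : ℝ :=
  (∏ i, (1 / (M i : ℝ))) * ∏ n, (ch.Q (ch.input f w z n) (y n) * ch.P (y n) (z n))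

open Classical in
/-- The probability that at least one of the three messages is decoded incorrectly. -/
def errorProb (ch : ICFB) {M : Fin 3 → ℕ} {N : ℕ} (f : ch.Encoder M N) (g : ch.Decoder M N) : ℝ :=
  ∑ w : ∀ i, Fin (M i), ∑ y : Fin N → ∀ i, ch.Y i, ∑ z : Fin N → ∀ i, ch.Z i,
    if (fun i => g i (fun n => y n i)) ≠ w then ch.jointProb f w y z else 0

/-- The rate triple `R` is `η`-achievable by the feedback-block-code `(f, g)`. Rates are in bits
per channel use. -/
def AchievableBy (ch : ICFB) (η : ℝ) (R : Fin 3 → ℝ) {M : Fin 3 → ℕ} {N : ℕ}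
    (f : ch.Encoder M N) (g : ch.Decoder M N) : Prop :=
  ch.errorProb f g ≤ η ∧ ∀ i, R i - η ≤ 1 / (N : ℝ) * Real.logb 2 (M i)

/-- The rate triple `R` is `η`-achievable by the randomized coding strategy `μ`, a probability
measure on the encoding functions: with probability one there are decoders which, with the chosen
encoding functions, form a code by which `R` is `η`-achievable. -/
def AchievableByRandomized (ch : ICFB) (η : ℝ) (R : Fin 3 → ℝ) {M : Fin 3 → ℕ} {N : ℕ}
    (μ : PMF (ch.Encoder M N)) : Prop :=
  ∀ f ∈ μ.support, ∃ g : ch.Decoder M N, ch.AchievableBy η R f g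

/-- The rate triple `R` is `η`-achievable: by a feedback-block-code or by a randomized coding
strategy, with some positive numbers of messages and some positive blocklength. -/
def EpsAchievable (ch : ICFB) (η : ℝ) (R : Fin 3 → ℝ) : Prop :=
  ∃ (M : Fin 3 → ℕ) (N : ℕ), (∀ i, 0 < M i) ∧ 0 < N ∧
    ((∃ (f : ch.Encoder M N) (g : ch.Decoder M N), ch.AchievableBy η R f g) ∨
      ∃ μ : PMF (ch.Encoder M N), ch.AchievableByRandomized η R μ)

/-- The feedback-capacity region: all rate triples that are `η`-achievable for every `η > 0`. -/
def feedbackCapacity (ch : ICFB) : Set (Fin 3 → ℝ) :=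
  {R | ∀ η : ℝ, 0 < η → ch.EpsAchievable η R}

end ICFB

namespace Example1

/-- Input alphabets: `(X₁₁, X₁₂)`, `X₂`, `(X₃₂, X₃₃)`. All components are binary. -/
def In : Fin 3 → Type
  | 0 => Bool × Bool
  | 1 => Bool
  | 2 => Bool × Bool

/-- Output alphabets: `Y₁`, `(Y₂, Y₂')`, `Y₃`. All components are binary. -/
def Out : Fin 3 → Type
  | 0 => Bool
  | 1 => Bool × Bool
  | 2 => Bool

/-- Feedback alphabets: `Z₁ = Y₁`, no feedback at transmitter 2, `Z₃ = Y₃`. -/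
def Fb : Fin 3 → Type
  | 0 => Bool
  | 1 => Unit
  | 2 => Bool

instance instFintypeIn : ∀ i, Fintype (In i)
  | 0 => inferInstanceAs (Fintype (Bool × Bool))
  | 1 => inferInstanceAs (Fintype Bool)
  | 2 => inferInstanceAs (Fintype (Bool × Bool))

instance instFintypeOut : ∀ i, Fintype (Out i)
  | 0 => inferInstanceAs (Fintype Bool)
  | 1 => inferInstanceAs (Fintype (Bool × Bool))
  | 2 => inferInstanceAs (Fintype Bool)

instance instFintypeFb : ∀ i, Fintype (Fb i)
  | 0 => inferInstanceAs (Fintype Bool)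
  | 1 => inferInstanceAs (Fintype Unit)
  | 2 => inferInstanceAs (Fintype Bool)

/-- A realization of the channel noise. -/
structure Noise where
  np : Bool
  nδ : Bool
  nε : Bool
  e : Bool

/-- A realization of the noise as a tuple of bits. -/
def noiseEquiv : (Bool × Bool × Bool × Bool) ≃ Noise where
  toFun b := ⟨b.1, b.2.1, b.2.2.1, b.2.2.2⟩
  invFun v := (v.np, v.nδ, v.nε, v.e)
  left_inv _ := rfl
  right_inv _ := rfl

instance instFintypeNoise : Fintype Noise := Fintype.ofEquiv _ noiseEquiv

/-- The Bernoulli probability mass function with parameter `q`. -/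
def bern (q : ℝ) (b : Bool) : ℝ := if b then q else 1 - q

/-- The law of the noise: independent Bernoulli variables `N_p`, `N_δ`, `N_ε`, `E` with parameters
`p`, `δ`, `ε`, `1/2`. -/
def noiseProb (p δ ε : ℝ) (v : Noise) : ℝ :=
  bern p v.np * bern δ v.nδ * bern ε v.nε * bern (1 / 2) v.e

/-- The channel outputs, as a function of the inputs and of the noise:
`Y₁ = X₁₁ ⊕ N_p`, `Y₂ = X₂ ⊕ N_p`, `Y₂' = X₁₂ ⊕ N_δ ⊕ ((X₁₂ ⊕ X₃₂) ∧ E)`,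
`Y₃ = X₃₃ ⊕ N_p ⊕ N_ε`. -/
def output (x : ∀ i, In i) (v : Noise) : ∀ i, Out i :=
  let x1 : Bool × Bool := x 0
  let x2 : Bool := x 1
  let x3 : Bool × Bool := x 2
  fun
  | 0 => (xor x1.1 v.np : Bool)
  | 1 => ((xor x2 v.np, xor (xor x1.2 v.nδ) (xor x1.2 x3.1 && v.e)) : Bool × Bool)
  | 2 => (xor (xor x3.2 v.np) v.nε : Bool)

/-- The noiseless feedback `Z₁ = Y₁`, `Z₃ = Y₃`, with trivial `Z₂`. -/
def feedback (y : ∀ i, Out i) : ∀ i, Fb i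
  | 0 => y 0
  | 1 => ()
  | 2 => y 2

theorem bern_nonneg (q : unitInterval) (b : Bool) : 0 ≤ bern q b := by
  have h0 := q.2.1
  have h1 := q.2.2
  unfold bern
  split_ifs <;> linarith

theorem noiseProb_nonneg (p δ ε : unitInterval) (v : Noise) : 0 ≤ noiseProb p δ ε v := by
  have h : 0 ≤ bern (1 / 2) v.e := by
    unfold bern
    split_ifs <;> norm_num
  exact mul_nonneg (mul_nonneg (mul_nonneg (bern_nonneg p _) (bern_nonneg δ _))
    (bern_nonneg ε _)) h

theorem noiseProb_sum (p δ ε : ℝ) : ∑ v, noiseProb p δ ε v = 1 := by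
  rw [← noiseEquiv.sum_comp]
  simp only [Fintype.sum_prod_type, Fintype.sum_bool, noiseProb, noiseEquiv, bern,
    Equiv.coe_fn_mk, if_true]
  simp
  ring

open Classical in
/-- The interference channel with feedback of the example, for noise parameters `p`, `δ`, `ε`. -/
def channel (p δ ε : unitInterval) : ICFB where
  X := In
  Y := Out
  Z := Fb
  Q x y := ∑ v : Noise, if output x v = y then noiseProb p δ ε v else 0
  Q_nonneg x y := Finset.sum_nonneg fun v _ => by
    split_ifs
    · exact noiseProb_nonneg p δ ε v
    · exact le_rfl
  Q_sum x := by
    rw [Finset.sum_comm]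
    simp [noiseProb_sum]
  P y z := if feedback y = z then 1 else 0
  P_nonneg y z := by
    split_ifs <;> norm_num
  P_sum y := by simp

end Example1

end

open Filter Topology

/-! The channel enters only through the continuity of its transition law in `ε`, with alphabets
independent of `ε`. For a fixed code the error probability is a finite sum of products of transition
probabilities, so a code with error at most `η / 2` at `ε = 0` has error below `η` for all small `ε`
(`continuous_errorProb`).

Capacity demands arbitrarily small error at a fixed `ε`. Hence the code is frozen and used as an
inner code over many blocks, with Gilbert–Varshamov outer codes correcting the few blocks that fail
(`exists_code_of_outer_code`, `mem_feedbackCapacity_of_code`). The rate loss vanishes with `η`, so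
every loss `c > 0` is admissible below some threshold on `ε` (`exists_threshold`). The thresholds
for `c = 2⁻ᵏ` are glued into one continuous `ζ` (`exists_continuous_majorant`). -/

theorem sum_prod_causal {S : Type*} [Fintype S] (N : ℕ)
    (q : ∀ n : Fin N, (Fin (n : ℕ) → S) → S → ℝ) (hq : ∀ n h, ∑ s, q n h s = 1) :
    ∑ s : Fin N → S, ∏ n, q n (fun k => s (k.castLE n.isLt.le)) (s n) = 1 := by
  induction N with
  | zero => simp
  | succ N ih =>
    -- By causality the last symbol occurs only in the last factor, so it is summed out first.
    rw [← (Fin.snocEquiv (fun _ => S)).sum_comp, Fintype.sum_prod_type, Finset.sum_comm]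
    have key : ∀ (t : Fin N → S) (a : S),
        ∏ n : Fin (N + 1), q n (fun k => (Fin.snocEquiv (fun _ => S)) (a, t)
          (k.castLE n.isLt.le)) ((Fin.snocEquiv (fun _ => S)) (a, t) n) =
        (∏ n : Fin N, q n.castSucc (fun k => t (k.castLE n.isLt.le)) (t n)) *
          q (Fin.last N) t a := by
      intro t a
      rw [Fin.prod_univ_castSucc]
      congr 1
      · refine Finset.prod_congr rfl fun n _ => ?_
        congr 1
        · funext k
          exact Fin.snoc_castSucc (α := fun _ => S) a t (k.castLE n.isLt.le)
        · exact Fin.snoc_castSucc (α := fun _ => S) a t n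
      · congr 1
        · funext k
          exact Fin.snoc_castSucc (α := fun _ => S) a t k
        · exact Fin.snoc_last (α := fun _ => S) a t
    simp_rw [key, ← Finset.mul_sum, hq, mul_one]
    exact ih (fun n => q n.castSucc) fun n h => hq n.castSucc h

/-! ### Hamming balls, outer codes and error counts -/

theorem pow_hammingDist_eq_prod {ι α : Type*} [Fintype ι] [DecidableEq α]
    (s : ℝ) (x y : ι → α) :
    s ^ hammingDist x y = ∏ i, if x i ≠ y i then s else 1 := by
  rw [Finset.prod_ite]
  simp [hammingDist]

theorem sum_pow_hammingDist_le {ι α : Type*} [Fintype ι] [DecidableEq ι] [Fintype α]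
    [DecidableEq α] {s : ℝ} (hs : 0 ≤ s) (y : ι → α) :
    ∑ x : ι → α, s ^ hammingDist x y ≤ (1 + Fintype.card α * s) ^ Fintype.card ι := by
  have h : ∑ x : ι → α, s ^ hammingDist x y = ∏ i, ∑ a : α, if a ≠ y i then s else 1 := by
    simp_rw [pow_hammingDist_eq_prod]
    rw [Finset.prod_univ_sum, Fintype.piFinset_univ]
  rw [h, ← Finset.card_univ (α := ι), ← Finset.prod_const]
  refine Finset.prod_le_prod (fun i _ => Finset.sum_nonneg fun a _ => by
    split_ifs <;> positivity) fun i _ => ?_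
  calc ∑ a : α, (if a ≠ y i then s else 1) ≤ ∑ a : α, ((if a = y i then 1 else 0) + s) := by
        refine Finset.sum_le_sum fun a _ => ?_
        by_cases h : a = y i <;> simp [h, hs]
    _ = 1 + Fintype.card α * s := by simp [Finset.sum_add_distrib]

/-- Chernoff bound: every point of the ball has weight `s ^ dist * s ^ (-r) ≥ 1`, and the total
weight factors over coordinates. -/
theorem card_hammingBall_le {ι α : Type*} [Fintype ι] [DecidableEq ι] [Fintype α]
    [DecidableEq α] {s : ℝ} (hs : 0 < s) (hs1 : s ≤ 1) (r : ℝ) (y : ι → α) :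
    ((Finset.univ.filter fun x : ι → α => (hammingDist x y : ℝ) < r).card : ℝ) ≤
      (1 + Fintype.card α * s) ^ Fintype.card ι * s ^ (-r) := by
  calc ((Finset.univ.filter fun x : ι → α => (hammingDist x y : ℝ) < r).card : ℝ)
      = ∑ x ∈ Finset.univ.filter fun x : ι → α => (hammingDist x y : ℝ) < r, (1 : ℝ) := by simp
    _ ≤ ∑ x ∈ Finset.univ.filter fun x : ι → α => (hammingDist x y : ℝ) < r,
          s ^ hammingDist x y * s ^ (-r) := by
        refine Finset.sum_le_sum fun x hx => ?_
        rw [← Real.rpow_natCast, ← Real.rpow_add hs]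
        exact Real.one_le_rpow_of_pos_of_le_one_of_nonpos hs hs1
          (by have := (Finset.mem_filter.1 hx).2; linarith)
    _ ≤ ∑ x : ι → α, s ^ hammingDist x y * s ^ (-r) :=
        Finset.sum_le_sum_of_subset_of_nonneg (Finset.filter_subset _ _)
          fun x _ _ => by positivity
    _ ≤ _ := by
        rw [← Finset.sum_mul]
        gcongr
        exact sum_pow_hammingDist_le hs.le y

/-- The Gilbert–Varshamov bound, with an exponential bound for the volume of Hamming balls. -/
theorem exists_gilbert_varshamov_code {ι α : Type*} [Fintype ι] [DecidableEq ι] [Fintype α]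
    [DecidableEq α] {s : ℝ} (hs : 0 < s) (hs1 : s ≤ 1) (r : ℝ) (hr : 0 < r) :
    ∃ S : Finset (ι → α), (∀ x ∈ S, ∀ y ∈ S, x ≠ y → r ≤ (hammingDist x y : ℝ)) ∧
      (Fintype.card α : ℝ) ^ Fintype.card ι ≤
        S.card * ((1 + Fintype.card α * s) ^ Fintype.card ι * s ^ (-r)) := by
  classical
  let good : Finset (Finset (ι → α)) := Finset.univ.filter fun S =>
    ∀ x ∈ S, ∀ y ∈ S, x ≠ y → r ≤ (hammingDist x y : ℝ)
  obtain ⟨S, hS, hmax⟩ := good.exists_max_image Finset.card ⟨∅, by simp [good]⟩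
  have hS' : ∀ x ∈ S, ∀ y ∈ S, x ≠ y → r ≤ (hammingDist x y : ℝ) := by
    simpa [good] using hS
  refine ⟨S, hS', ?_⟩
  -- A point outside all balls of radius `r` could be added to `S`, against maximality.
  have hcov : (Finset.univ : Finset (ι → α)) ⊆
      S.biUnion fun y => Finset.univ.filter fun x : ι → α => (hammingDist x y : ℝ) < r := by
    intro x _
    by_contra hx
    simp only [Finset.mem_biUnion, Finset.mem_filter, Finset.mem_univ, true_and, not_exists,
      not_and, not_lt] at hx
    have hxS : x ∉ S := fun h => by
      have := hx x h
      simp only [hammingDist_self, Nat.cast_zero] at this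
      linarith
    have := hmax (insert x S) (by
      simp only [good, Finset.mem_filter, Finset.mem_univ, true_and, Finset.mem_insert]
      rintro a (rfl | ha) b (rfl | hb) hab
      · exact absurd rfl hab
      · exact hx b hb
      · rw [hammingDist_comm]; exact hx a ha
      · exact hS' a ha b hb hab)
    rw [Finset.card_insert_of_notMem hxS] at this
    omega
  calc (Fintype.card α : ℝ) ^ Fintype.card ι
      = ((Finset.univ : Finset (ι → α)).card : ℝ) := by simp
    _ ≤ ∑ y ∈ S, ((Finset.univ.filter fun x : ι → α =>
          (hammingDist x y : ℝ) < r).card : ℝ) := by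
        exact_mod_cast (Finset.card_le_card hcov).trans Finset.card_biUnion_le
    _ ≤ ∑ y ∈ S, (1 + Fintype.card α * s) ^ Fintype.card ι * s ^ (-r) :=
        Finset.sum_le_sum fun y _ => card_hammingBall_le hs hs1 r y
    _ = _ := by simp

theorem exists_hamming_decoder {ι α β : Type*} [Fintype ι] [DecidableEq α] [Nonempty β]
    (r : ℝ) (D : β → ι → α) (hD : ∀ m m', m ≠ m' → 2 * r ≤ (hammingDist (D m) (D m') : ℝ)) :
    ∃ dec : (ι → α) → β, ∀ m v, (hammingDist (D m) v : ℝ) < r → dec v = m := by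
  classical
  refine ⟨fun v => if h : ∃ m, (hammingDist (D m) v : ℝ) < r then h.choose
    else Classical.arbitrary β, fun m v hm => ?_⟩
  have h : ∃ m, (hammingDist (D m) v : ℝ) < r := ⟨m, hm⟩
  simp only [dif_pos h]
  by_contra hne
  have h1 := hD _ _ hne
  have h2 := h.choose_spec
  have h3 : (hammingDist (D h.choose) (D m) : ℝ) ≤
      hammingDist (D h.choose) v + hammingDist (D m) v := by
    rw [hammingDist_comm (D m) v]
    exact_mod_cast hammingDist_triangle _ v _
  linarith

/-- Exponential Markov inequality for the number of errors in independent trials. -/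
theorem sum_sum_errors_ge_le {ι U O : Type*} [Fintype ι] [DecidableEq ι] [Fintype U]
    [DecidableEq U] [Fintype O] (W : U → O → ℝ) (hW : ∀ u o, 0 ≤ W u o)
    (hW1 : ∀ u, ∑ o, W u o = 1) (dec : O → U) {q : ℝ}
    (hq : ∑ u, ∑ o, (if dec o ≠ u then W u o else 0) ≤ Fintype.card U * q) (r : ℝ) :
    ∑ u : ι → U, ∑ o : ι → O,
      (if r ≤ (hammingDist (fun b => dec (o b)) u : ℝ) then ∏ b, W (u b) (o b) else 0) ≤
      2 ^ (-r) * (Fintype.card U * (1 + q)) ^ Fintype.card ι := by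
  calc ∑ u : ι → U, ∑ o : ι → O,
      (if r ≤ (hammingDist (fun b => dec (o b)) u : ℝ) then ∏ b, W (u b) (o b) else 0)
      -- The indicator is at most `2 ^ (errors - r)`, which factors over the trials.
      ≤ ∑ u : ι → U, ∑ o : ι → O, 2 ^ (-r) *
          ∏ b, ((if dec (o b) ≠ u b then 2 else 1) * W (u b) (o b)) := by
        refine Finset.sum_le_sum fun u _ => Finset.sum_le_sum fun o _ => ?_
        have hp : 0 ≤ ∏ b, W (u b) (o b) := Finset.prod_nonneg fun b _ => hW _ _
        rw [Finset.prod_mul_distrib, ← pow_hammingDist_eq_prod 2 (fun b => dec (o b)) u,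
          ← mul_assoc, ← Real.rpow_natCast, ← Real.rpow_add two_pos]
        split_ifs with h
        · exact le_mul_of_one_le_left hp (Real.one_le_rpow one_le_two (by linarith))
        · positivity
    _ = 2 ^ (-r) * (∑ u, ∑ o, (if dec o ≠ u then 2 else 1) * W u o) ^ Fintype.card ι := by
        simp_rw [← Finset.mul_sum]
        congr 1
        rw [← Finset.card_univ (α := ι), ← Finset.prod_const, Finset.prod_univ_sum,
          Fintype.piFinset_univ]
        refine Finset.sum_congr rfl fun u _ => ?_
        rw [Finset.prod_univ_sum, Fintype.piFinset_univ]
    _ ≤ _ := by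
        gcongr
        · exact Finset.sum_nonneg fun u _ => Finset.sum_nonneg fun o _ =>
            mul_nonneg (by split_ifs <;> norm_num) (hW _ _)
        · have : ∀ u, ∑ o, (if dec o ≠ u then 2 else 1) * W u o =
              1 + ∑ o, (if dec o ≠ u then W u o else 0) := by
            intro u
            nth_rewrite 2 [← hW1 u]
            rw [← Finset.sum_add_distrib]
            refine Finset.sum_congr rfl fun o _ => ?_
            split_ifs <;> ring
          simp_rw [this, Finset.sum_add_distrib]
          simp only [Finset.sum_const, Finset.card_univ, nsmul_eq_mul]
          linarith

/-! ### Concatenation with an inner feedback code -/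

namespace ICFB

/-- The conditional probability of a sequence of output and feedback triples, given the
messages. -/
noncomputable def condProb (ch : ICFB) {M : Fin 3 → ℕ} {N : ℕ} (f : ch.Encoder M N)
    (w : ∀ i, Fin (M i)) (s : Fin N → (∀ i, ch.Y i) × (∀ i, ch.Z i)) : ℝ :=
  ∏ n, (ch.Q (ch.input f w (fun k => (s k).2) n) (s n).1 * ch.P (s n).1 (s n).2)

/-- The decoded message triple. -/
def decoded (ch : ICFB) {M : Fin 3 → ℕ} {N : ℕ} (g : ch.Decoder M N)
    (s : Fin N → (∀ i, ch.Y i) × (∀ i, ch.Z i)) : ∀ i, Fin (M i) :=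
  fun i => g i fun n => (s n).1 i

theorem condProb_nonneg (ch : ICFB) {M : Fin 3 → ℕ} {N : ℕ} (f : ch.Encoder M N)
    (w : ∀ i, Fin (M i)) (s : Fin N → (∀ i, ch.Y i) × (∀ i, ch.Z i)) :
    0 ≤ ch.condProb f w s :=
  Finset.prod_nonneg fun _ _ => mul_nonneg (ch.Q_nonneg _ _) (ch.P_nonneg _ _)

theorem sum_condProb (ch : ICFB) {M : Fin 3 → ℕ} {N : ℕ} (f : ch.Encoder M N)
    (w : ∀ i, Fin (M i)) : ∑ s, ch.condProb f w s = 1 := by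
  refine sum_prod_causal N
    (fun n (h : Fin (n : ℕ) → (∀ i, ch.Y i) × (∀ i, ch.Z i)) t =>
      ch.Q (fun i => f i (w i) n fun k => (h k).2 i) t.1 * ch.P t.1 t.2) fun n h => ?_
  rw [Fintype.sum_prod_type]
  simp_rw [← Finset.mul_sum, ch.P_sum, mul_one, ch.Q_sum]

open Classical in
theorem errorProb_eq (ch : ICFB) {M : Fin 3 → ℕ} {N : ℕ} (f : ch.Encoder M N)
    (g : ch.Decoder M N) :
    ch.errorProb f g = (∏ i, (1 / (M i : ℝ))) *
      ∑ w, ∑ s, if ch.decoded g s ≠ w then ch.condProb f w s else 0 := by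
  unfold errorProb
  rw [Finset.mul_sum]
  refine Finset.sum_congr rfl fun w _ => ?_
  rw [← (Equiv.arrowProdEquivProdArrow (Fin N) (fun _ => ∀ i, ch.Y i)
    (fun _ => ∀ i, ch.Z i)).symm.sum_comp, Fintype.sum_prod_type, Finset.mul_sum]
  refine Finset.sum_congr rfl fun y _ => ?_
  rw [Finset.mul_sum]
  refine Finset.sum_congr rfl fun z _ => ?_
  rw [mul_ite, mul_zero]
  rfl

/-- The encoder that uses the encoder `f` in `L` consecutive blocks, in block `b` with the
messages given by the `b`-th letters of the outer codewords. -/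
def blockEncoder (ch : ICFB) {M M' : Fin 3 → ℕ} {N L : ℕ} (f : ch.Encoder M N)
    (c : ∀ i, Fin (M' i) → Fin L → Fin (M i)) : ch.Encoder M' (L * N) :=
  fun i m n h => f i (c i m n.divNat) n.modNat fun k => h ⟨k + N * n.divNat, by
    have h1 : (k : ℕ) < n % N := k.2
    have h2 := Nat.mod_add_div (n : ℕ) N
    have h3 : (n.divNat : ℕ) = n / N := rfl
    rw [h3]
    omega⟩

/-- Each block ignores feedback from earlier blocks, so the blocks are conditionally independent
given the messages. -/
theorem condProb_blockEncoder (ch : ICFB) {M M' : Fin 3 → ℕ} {N L : ℕ} (f : ch.Encoder M N)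
    (c : ∀ i, Fin (M' i) → Fin L → Fin (M i)) (w : ∀ i, Fin (M' i))
    (s : Fin (L * N) → (∀ i, ch.Y i) × (∀ i, ch.Z i)) :
    ch.condProb (ch.blockEncoder f c) w s =
      ∏ b, ch.condProb f (fun i => c i (w i) b) fun t => s (finProdFinEquiv (b, t)) := by
  unfold condProb
  rw [← Fintype.prod_prod_type' (f := fun (b : Fin L) (n : Fin N) =>
      ch.Q (ch.input f (fun i => c i (w i) b)
        (fun k => (s (finProdFinEquiv (b, k))).2) n) (s (finProdFinEquiv (b, n))).1 *
      ch.P (s (finProdFinEquiv (b, n))).1 (s (finProdFinEquiv (b, n))).2),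
    ← finProdFinEquiv.symm.prod_comp]
  refine Finset.prod_congr rfl fun n _ => ?_
  have h : finProdFinEquiv ((finProdFinEquiv.symm n).1, (finProdFinEquiv.symm n).2) = n :=
    finProdFinEquiv.apply_symm_apply n
  rw [h]
  rfl

/-- The inner error bound is only an average over messages, and outer codewords might favour bad
ones. A uniformly random shift of each user's letters, known to its encoder and decoder, makes the
inner messages uniform; some fixed shift does as well as the average. -/
theorem exists_code_of_outer_code (ch : ICFB) {M M' : Fin 3 → ℕ} {N L : ℕ}
    (hM : ∀ i, 0 < M i) (hM' : ∀ i, 0 < M' i) (f : ch.Encoder M N) (g : ch.Decoder M N) {q : ℝ}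
    (hq : ch.errorProb f g ≤ q) (r : ℝ) (D : ∀ i, Fin (M' i) → Fin L → Fin (M i))
    (hD : ∀ i m m', m ≠ m' → 2 * r ≤ (hammingDist (D i m) (D i m') : ℝ)) :
    ∃ (f' : ch.Encoder M' (L * N)) (g' : ch.Decoder M' (L * N)),
      ch.errorProb f' g' ≤ 2 ^ (-r) * (1 + q) ^ L := by
  classical
  have : ∀ i, NeZero (M i) := fun i => ⟨(hM i).ne'⟩
  have : ∀ i, Nonempty (Fin (M' i)) := fun i => ⟨⟨0, hM' i⟩⟩
  choose dec hdec using fun i => exists_hamming_decoder r (D i) (hD i)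
  let c : (Fin L → ∀ i, Fin (M i)) → ∀ i, Fin (M' i) → Fin L → Fin (M i) :=
    fun x i m b => D i m b + x b i
  let g' : (Fin L → ∀ i, Fin (M i)) → ch.Decoder M' (L * N) := fun x i y =>
    dec i fun b => g i (fun t => y (finProdFinEquiv (b, t))) - x b i
  let U := ∀ i, Fin (M i)
  let O := Fin N → (∀ i, ch.Y i) × (∀ i, ch.Z i)
  let G : (Fin L → U) → ℝ := fun u => ∑ o : Fin L → O,
    if r ≤ (hammingDist (fun b => ch.decoded g (o b)) u : ℝ) then
      ∏ b, ch.condProb f (u b) (o b) else 0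
  have hUpos : 0 < (Fintype.card U : ℝ) := by
    exact_mod_cast Fintype.card_pos
  have hUcard : (∏ i, (1 / (M i : ℝ))) = 1 / Fintype.card U := by
    simp [U, Fintype.card_pi]
  have hG : ∑ u, G u ≤ 2 ^ (-r) * (Fintype.card U * (1 + q)) ^ L := by
    have := sum_sum_errors_ge_le (ι := Fin L) (U := U) (O := O) (ch.condProb f)
      (ch.condProb_nonneg f) (ch.sum_condProb f) (ch.decoded g) (q := q) (by
        rw [errorProb_eq, hUcard, one_div, inv_mul_le_iff₀ hUpos] at hq
        exact hq) r
    rwa [Fintype.card_fin] at this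
  -- A user's wrong letters occur only in blocks whose triple is wrong; fewer than `r` such blocks
  -- are corrected for all users.
  have herr : ∀ x (w : ∀ i, Fin (M' i)),
      ∑ s, (if ch.decoded (g' x) s ≠ w then
        ch.condProb (ch.blockEncoder f (c x)) w s else 0) ≤
      G fun b i => D i (w i) b + x b i := by
    intro x w
    let e : (Fin L → O) ≃ (Fin (L * N) → (∀ i, ch.Y i) × (∀ i, ch.Z i)) :=
      (Equiv.curry _ _ _).symm.trans (finProdFinEquiv.arrowCongr (Equiv.refl _))
    have he : ∀ o b t, e o (finProdFinEquiv (b, t)) = o b t := by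
      intro o b t
      simp [e, Equiv.arrowCongr]
    rw [← e.sum_comp]
    refine Finset.sum_le_sum fun o _ => ?_
    rw [condProb_blockEncoder]
    simp_rw [he]
    have hnn : 0 ≤ ∏ b, ch.condProb f (fun i => c x i (w i) b) (o b) :=
      Finset.prod_nonneg fun b _ => ch.condProb_nonneg _ _ _
    split_ifs with h1 h2 h2
    · exact le_rfl
    · exfalso
      apply h1
      funext i
      apply hdec i
      refine lt_of_le_of_lt ?_ (not_le.1 h2)
      norm_cast
      refine Finset.card_le_card fun b hb => ?_
      simp only [Finset.mem_filter, Finset.mem_univ, true_and] at hb ⊢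
      intro heq
      apply hb
      have := congrFun heq i
      simp only [he]
      exact (sub_eq_of_eq_add this).symm
    · exact hnn
    · exact le_rfl
  have havg : ∑ x, ch.errorProb (ch.blockEncoder f (c x)) (g' x) ≤
      ∑ _x : Fin L → U, 2 ^ (-r) * (1 + q) ^ L := by
    have h1 : ∀ x, ch.errorProb (ch.blockEncoder f (c x)) (g' x) ≤
        (∏ i, (1 / (M' i : ℝ))) * ∑ w : ∀ i, Fin (M' i), G fun b i => D i (w i) b + x b i := by
      intro x
      rw [errorProb_eq]
      exact mul_le_mul_of_nonneg_left (Finset.sum_le_sum fun w _ => herr x w)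
        (Finset.prod_nonneg fun i _ => by positivity)
    refine (Finset.sum_le_sum fun x _ => h1 x).trans ?_
    rw [← Finset.mul_sum, Finset.sum_comm]
    -- For fixed `w`, the shift is a bijection onto all inner message sequences.
    have h2 : ∀ w : ∀ i, Fin (M' i),
        ∑ x : Fin L → U, G (fun b i => D i (w i) b + x b i) = ∑ u, G u := fun w =>
      Equiv.sum_comp (Equiv.addLeft fun (b : Fin L) (i : Fin 3) => D i (w i) b) G
    rw [Finset.sum_congr rfl fun w _ => h2 w]
    have h3 : (∏ i, (1 / (M' i : ℝ))) * ((Fintype.card (∀ i, Fin (M' i)) : ℕ) : ℝ) = 1 := by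
      rw [Fintype.card_pi]
      push_cast
      rw [← Finset.prod_mul_distrib]
      refine Finset.prod_eq_one fun i _ => ?_
      have : (M' i : ℝ) ≠ 0 := by exact_mod_cast (hM' i).ne'
      simp [this]
    rw [Finset.sum_const, Finset.card_univ, nsmul_eq_mul, ← mul_assoc, h3, one_mul,
      Finset.sum_const, Finset.card_univ, nsmul_eq_mul, Fintype.card_fun, Fintype.card_fin]
    refine hG.trans (le_of_eq ?_)
    push_cast
    rw [mul_pow, mul_left_comm]
  obtain ⟨x, -, hx⟩ := Finset.exists_le_of_sum_le
    (Finset.univ_nonempty (α := Fin L → U)) havg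
  exact ⟨_, _, hx⟩

end ICFB

/-! ### Error exponent and rate of the concatenated code -/

/-- With decoding radius `2 * η * L`, this base raised to the power `L` bounds the error, which
therefore tends to `0`. -/
theorem two_rpow_mul_one_add_lt_one {η : ℝ} (hη : 0 < η) : (2 : ℝ) ^ (-(2 * η)) * (1 + η) < 1 := by
  have h1 : 1 + η < Real.exp η := by
    have := Real.add_one_lt_exp hη.ne'
    linarith
  have h2 : Real.exp η ≤ 2 ^ (2 * η) := by
    rw [Real.rpow_def_of_pos two_pos]
    refine Real.exp_le_exp.2 ?_
    have := Real.log_two_gt_d9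
    nlinarith
  rw [Real.rpow_neg two_pos.le, inv_mul_lt_iff₀ (by positivity), mul_one]
  linarith

namespace ICFB

/-- Concatenating a code of error probability at most `η` with good outer codes gives codes with
arbitrarily small error probability, at a small loss of rate. -/
theorem mem_feedbackCapacity_of_code (ch : ICFB) {M : Fin 3 → ℕ} {N : ℕ} (hM : ∀ i, 0 < M i)
    (hN : 0 < N) (f : ch.Encoder M N) (g : ch.Decoder M N) {η : ℝ} (hη : 0 < η)
    (hη4 : 4 * η ≤ 1) (herr : ch.errorProb f g ≤ η) {ρ r : Fin 3 → ℝ}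
    (hρ : ∀ i, ρ i ≤ 1 / (N : ℝ) * Real.logb 2 (M i))
    (hr : ∀ i, r i ≤ (1 - 4 * η) * ρ i - Real.logb 2 (1 + η) + 4 * η * Real.logb 2 η) :
    r ∈ ch.feedbackCapacity := by
  intro η' hη'
  have hκ0 : 0 ≤ (2 : ℝ) ^ (-(2 * η)) * (1 + η) := by positivity
  obtain ⟨L, hL⟩ := ((tendsto_pow_atTop_nhds_zero_of_lt_one hκ0
    (two_rpow_mul_one_add_lt_one hη)).eventually (ge_mem_nhds hη')).and
      (eventually_gt_atTop 0) |>.exists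
  obtain ⟨hLη, hL0⟩ := hL
  have hLR : (0 : ℝ) < L := by exact_mod_cast hL0
  have hMR : ∀ i, (1 : ℝ) ≤ M i := fun i => by exact_mod_cast hM i
  have hs : ∀ i, 0 < η / M i := fun i => div_pos hη (by linarith [hMR i])
  -- The distance is twice the decoding radius, and `s = η / M i` turns the ball bound's base into
  -- `1 + η`.
  choose S hSd hSc using fun i => exists_gilbert_varshamov_code (ι := Fin L) (α := Fin (M i))
    (hs i) ((div_le_one (by linarith [hMR i])).2 (by linarith [hMR i])) (2 * (2 * η * L))
    (by positivity)
  have hSpos : ∀ i, 0 < (S i).card := by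
    intro i
    rw [Nat.pos_iff_ne_zero]
    intro h0
    have h1 := hSc i
    rw [h0, Fintype.card_fin, Nat.cast_zero, zero_mul] at h1
    have : (0 : ℝ) < (M i : ℝ) ^ Fintype.card (Fin L) := pow_pos (by linarith [hMR i]) _
    linarith
  obtain ⟨f', g', hfg⟩ := ch.exists_code_of_outer_code hM hSpos f g herr (2 * η * L)
    (fun i m => ((S i).equivFin.symm m : Fin L → Fin (M i))) (fun i m m' hm => by
      refine hSd i _ (Subtype.prop _) _ (Subtype.prop _) fun h => hm ?_
      exact (S i).equivFin.symm.injective (Subtype.ext h))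
  refine ⟨fun i => (S i).card, L * N, hSpos, Nat.mul_pos hL0 hN, Or.inl ⟨f', g', ?_, ?_⟩⟩
  · refine hfg.trans (le_trans (le_of_eq ?_) hLη)
    rw [mul_pow, ← Real.rpow_natCast ((2 : ℝ) ^ (-(2 * η))), ← Real.rpow_mul two_pos.le]
    congr 2
    ring
  · intro i
    have hMi : (0 : ℝ) < M i := by linarith [hMR i]
    have hSi : (0 : ℝ) < (S i).card := by exact_mod_cast hSpos i
    have hNR : (1 : ℝ) ≤ N := by exact_mod_cast hN
    have h1 := hSc i
    rw [Fintype.card_fin, Fintype.card_fin, mul_div_cancel₀ _ hMi.ne'] at h1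
    have h2 := Real.logb_le_logb_of_le one_lt_two (pow_pos hMi L) h1
    rw [Real.logb_mul hSi.ne' (by have := hs i; positivity), Real.logb_mul (by positivity)
      (by have := hs i; positivity), Real.logb_pow, Real.logb_pow,
      Real.logb_rpow_eq_mul_logb_of_pos (hs i), Real.logb_div hη.ne' hMi.ne'] at h2
    set m := Real.logb 2 (M i)
    set a := Real.logb 2 (1 + η)
    set b := Real.logb 2 η
    have ha : 0 ≤ a := Real.logb_nonneg one_lt_two (by linarith)
    have hb : b ≤ 0 := Real.logb_nonpos one_lt_two hη.le (by linarith)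
    have h3 : (1 - 4 * η) * m - a + 4 * η * b ≤ 1 / L * Real.logb 2 (S i).card := by
      rw [one_div, le_inv_mul_iff₀ hLR]
      linarith
    -- The terms `-a` and `4 * η * b` are nonpositive, so the factor `1 / N ≤ 1` only reduces the
    -- loss.
    have h4 : (1 - 4 * η) * ρ i - a + 4 * η * b ≤
        1 / N * ((1 - 4 * η) * m - a + 4 * η * b) := by
      have h5 := mul_le_mul_of_nonneg_left (hρ i) (by linarith : 0 ≤ 1 - 4 * η)
      have h6 : 1 / (N : ℝ) ≤ 1 := by
        rw [div_le_one (by linarith)]; exact hNR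
      have h7 : 4 * η * b ≤ 0 := mul_nonpos_of_nonneg_of_nonpos (by linarith) hb
      nlinarith
    have h8 := mul_le_mul_of_nonneg_left h3 (by positivity : 0 ≤ 1 / (N : ℝ))
    have h9 : 1 / ((L * N : ℕ) : ℝ) * Real.logb 2 (S i).card =
        1 / N * (1 / L * Real.logb 2 (S i).card) := by
      push_cast
      field_simp
    rw [h9]
    linarith [hr i]

theorem EpsAchievable.exists_code {ch : ICFB} {η : ℝ} {R : Fin 3 → ℝ}
    (h : ch.EpsAchievable η R) :
    ∃ (M : Fin 3 → ℕ) (N : ℕ), (∀ i, 0 < M i) ∧ 0 < N ∧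
      ∃ (f : ch.Encoder M N) (g : ch.Decoder M N), ch.AchievableBy η R f g := by
  obtain ⟨M, N, hM, hN, h | ⟨μ, h⟩⟩ := h
  · exact ⟨M, N, hM, hN, h⟩
  · obtain ⟨f, hf⟩ := μ.support_nonempty
    exact ⟨M, N, hM, hN, f, h f hf⟩

theorem feedbackCapacity_mono {ch : ICFB} {R R' : Fin 3 → ℝ} (hR : R ∈ ch.feedbackCapacity)
    (h : ∀ i, R' i ≤ R i) : R' ∈ ch.feedbackCapacity := by
  intro η hη
  obtain ⟨M, N, hM, hN, f, g, he, hr⟩ := (hR η hη).exists_code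
  exact ⟨M, N, hM, hN, Or.inl ⟨f, g, he, fun i => by linarith [hr i, h i]⟩⟩

end ICFB

/-! ### Continuity in `ε` and choice of `ζ` -/

theorem continuous_bern (b : Bool) : Continuous fun q : ℝ => Example1.bern q b := by
  cases b
  all_goals
    simp only [Example1.bern, Bool.false_eq_true, if_true, if_false]
    fun_prop

theorem continuous_channel_Q (p δ : unitInterval) (x : ∀ i, Example1.In i)
    (y : ∀ i, Example1.Out i) :
    Continuous fun ε : unitInterval => (Example1.channel p δ ε).Q x y := by
  classical
  change Continuous fun ε : unitInterval => ∑ v : Example1.Noise,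
    if Example1.output x v = y then Example1.noiseProb p δ ε v else 0
  refine continuous_finsetSum _ fun v _ => ?_
  split_ifs
  · exact ((continuous_const.mul continuous_const).mul
      ((continuous_bern _).comp continuous_subtype_val)).mul continuous_const
  · exact continuous_const

theorem continuous_errorProb (p δ : unitInterval) {M : Fin 3 → ℕ} {N : ℕ}
    (f : (Example1.channel p δ 0).Encoder M N) (g : (Example1.channel p δ 0).Decoder M N) :
    Continuous fun ε : unitInterval => (Example1.channel p δ ε).errorProb f g := by
  classical
  change Continuous fun ε : unitInterval => ∑ w : ∀ i, Fin (M i),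
    ∑ y : Fin N → ∀ i, Example1.Out i, ∑ z : Fin N → ∀ i, Example1.Fb i,
      if (fun i => g i (fun n => y n i)) ≠ w then
        (Example1.channel p δ ε).jointProb f w y z else 0
  refine continuous_finsetSum _ fun w _ => continuous_finsetSum _ fun y _ =>
    continuous_finsetSum _ fun z _ => ?_
  split_ifs
  · exact continuous_const.mul (continuous_finsetProd _ fun n _ =>
      (continuous_channel_Q p δ _ _).mul continuous_const)
  · exact continuous_const

theorem exists_pos_rate_loss_le (R : Fin 3 → ℝ) {c : ℝ} (hc : 0 < c) :
    ∃ η : ℝ, 0 < η ∧ 4 * η ≤ 1 ∧ ∀ i, R i - c ≤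
      (1 - 4 * η) * (R i - η) - Real.logb 2 (1 + η) + 4 * η * Real.logb 2 η := by
  have key : ∀ i, ∀ᶠ η : ℝ in 𝓝[>] 0, R i - c ≤
      (1 - 4 * η) * (R i - η) - Real.logb 2 (1 + η) + 4 * η * Real.logb 2 η := by
    intro i
    -- Grouping `η * log η` gives a function continuous at `0`, with value `R i` there.
    have h : ContinuousAt (fun η : ℝ =>
        (1 - 4 * η) * (R i - η) - Real.log (1 + η) / Real.log 2 +
          4 * (η * Real.log η) / Real.log 2) 0 := by
      refine ContinuousAt.add (ContinuousAt.sub (by fun_prop) (ContinuousAt.div_const ?_ _)) ?_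
      · exact ContinuousAt.log (by fun_prop) (by norm_num)
      · exact ((continuous_const.mul Real.continuous_mul_log).div_const _).continuousAt
    have h2 := h.tendsto.mono_left (nhdsWithin_le_nhds (s := Set.Ioi 0))
    filter_upwards [h2.eventually (lt_mem_nhds (a := R i - c) (by simpa using hc))] with η hη
    refine hη.le.trans (le_of_eq ?_)
    simp only [Real.logb]
    ring
  obtain ⟨η, h1, h2, h3⟩ := ((eventually_all.2 key).and
    ((eventually_mem_nhdsWithin (a := (0 : ℝ)) (s := Set.Ioi 0)).and
      (nhdsWithin_le_nhds (ge_mem_nhds (by norm_num : (0 : ℝ) < 1 / 4))))).exists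
  exact ⟨η, h2, by linarith [show η ≤ 1 / 4 from h3], h1⟩

theorem exists_threshold (p δ : unitInterval) {R : Fin 3 → ℝ}
    (hR : R ∈ (Example1.channel p δ 0).feedbackCapacity) {c : ℝ} (hc : 0 < c) :
    ∃ e : ℝ, 0 < e ∧ ∀ ε : unitInterval, (ε : ℝ) < e →
      (fun i => R i - c) ∈ (Example1.channel p δ ε).feedbackCapacity := by
  obtain ⟨η, hη, hη4, hloss⟩ := exists_pos_rate_loss_le R hc
  obtain ⟨M, N, hM, hN, f, g, he, hr⟩ := (hR (η / 2) (by linarith)).exists_code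
  obtain ⟨e, he0, hball⟩ := Metric.mem_nhds_iff.1
    ((continuous_errorProb p δ f g).continuousAt.eventually
      (gt_mem_nhds (lt_of_le_of_lt he (by linarith : η / 2 < η))))
  refine ⟨e, he0, fun ε hε => ?_⟩
  have h1 : (Example1.channel p δ ε).errorProb f g < η := by
    refine hball (a := ε) ?_
    rw [Metric.mem_ball, Subtype.dist_eq, Real.dist_eq]
    simpa [abs_of_nonneg ε.2.1] using hε
  exact (Example1.channel p δ ε).mem_feedbackCapacity_of_code hM hN f g hη hη4 h1.le
    (ρ := fun i => R i - η) (fun i => by linarith [hr i]) hloss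

/-- A continuous function vanishing at `0` that dominates the step function with value `2⁻ᵏ`
between consecutive thresholds. -/
theorem exists_continuous_majorant (e : ℕ → ℝ) (he : ∀ k, 0 < e k) :
    ∃ ζ : ℝ → ℝ, Continuous ζ ∧ ζ 0 = 0 ∧
      ∀ x, 0 < x → x < e 0 → ∃ k, x < e k ∧ (1 / 2 : ℝ) ^ k ≤ ζ x := by
  -- The cap forces the thresholds to `0`, so every positive `x` exceeds one.
  let e' : ℕ → ℝ := fun k => min (e k) ((1 / 2) ^ k)
  have he' : ∀ k, 0 < e' k := fun k => lt_min (he k) (by positivity)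
  -- Ramp `k` reaches full height `2⁻ᵏ` already at threshold `k + 1`. The least `k` with `e' (k + 1)
  -- ≤ x` thus gives `ζ x ≥ 2⁻ᵏ`, while minimality, or `x < e 0` if `k = 0`, gives `x < e k`.
  let u : ℕ → ℝ → ℝ := fun k x => (1 / 2) ^ k * min 1 (|x| / e' (k + 1))
  have hu0 : ∀ k x, 0 ≤ u k x := fun k x => by
    have := he' (k + 1)
    positivity
  have hu1 : ∀ k x, u k x ≤ (1 / 2) ^ k := fun k x =>
    mul_le_of_le_one_right (by positivity) (min_le_left _ _)
  have hsum : Summable fun k : ℕ => (1 / 2 : ℝ) ^ k := summable_geometric_two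
  have hus : ∀ x, Summable fun k => u k x := fun x =>
    Summable.of_nonneg_of_le (fun k => hu0 k x) (fun k => hu1 k x) hsum
  refine ⟨fun x => ∑' k, u k x, ?_, by simp [u], fun x hx hx0 => ?_⟩
  · refine continuous_tsum (fun k => ?_) hsum fun k x => ?_
    · exact continuous_const.mul (continuous_const.min (continuous_abs.div_const _))
    · rw [Real.norm_of_nonneg (hu0 k x)]
      exact hu1 k x
  · have hex : ∃ k, e' (k + 1) ≤ x := by
      obtain ⟨k, hk⟩ := exists_pow_lt_of_lt_one hx (by norm_num : (1 / 2 : ℝ) < 1)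
      refine ⟨k, (min_le_right _ _).trans (le_trans ?_ hk.le)⟩
      exact pow_le_pow_of_le_one (by norm_num) (by norm_num) k.le_succ
    classical
    refine ⟨Nat.find hex, ?_, ?_⟩
    · rcases h : Nat.find hex with _ | k
      · exact hx0
      · have := Nat.find_min hex (m := k) (by omega)
        exact lt_of_lt_of_le (not_le.1 this) (min_le_left _ _)
    · refine le_trans (le_of_eq ?_) ((hus x).le_tsum (Nat.find hex) fun k _ => hu0 k x)
      have h1 : 1 ≤ |x| / e' (Nat.find hex + 1) := by
        rw [one_le_div (he' _), abs_of_pos hx]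
        exact Nat.find_spec hex
      simp only [u, min_eq_left h1, mul_one]

theorem lemma2 (p δ : unitInterval) (R : Fin 3 → ℝ)
    (hR : R ∈ (Example1.channel p δ 0).feedbackCapacity) :
    ∃ ζ : ℝ → ℝ, Continuous ζ ∧ Tendsto ζ (𝓝[>] 0) (𝓝 0) ∧
      ∃ ε₀ : ℝ, 0 < ε₀ ∧ ∀ ε : unitInterval, 0 < (ε : ℝ) → (ε : ℝ) < ε₀ →
        (fun i => R i - ζ ε) ∈ (Example1.channel p δ ε).feedbackCapacity := by
  choose e he hcap using fun k : ℕ =>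
    exists_threshold p δ hR (c := (1 / 2) ^ k) (by positivity)
  obtain ⟨ζ, hζ, hζ0, hmaj⟩ := exists_continuous_majorant e he
  refine ⟨ζ, hζ, ?_, e 0, he 0, fun ε h0 h1 => ?_⟩
  · have := hζ.tendsto 0
    rw [hζ0] at this
    exact this.mono_left nhdsWithin_le_nhds
  · obtain ⟨k, hk, hle⟩ := hmaj ε h0 h1
    exact ICFB.feedbackCapacity_mono (hcap k ε hk) fun i => by linarith
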